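/- Let $\Sigma$ and $\Gamma$ be finite alphabets. A Büchi transducer $\mathcal T=(K,\Sigma,\Gamma,\Delta,q_0,F)$ consists of a finite set $K$ of states, an initial state $q_0\in K$, a set $F\subseteq K$ of accepting states and a finite set $\Delta\subseteq K\times\Sigma^\star\times\Gamma^\star\times K$ of transitions. A computation is an infinite sequence of transitions $(q_0,u_1,v_1,q_1),(q_1,u_2,v_2,q_2),\ldots$ in $\Delta$; it is successful if some $q_f\in F$ satisfies $q_i=q_f$ for infinitely many $i$. Its input word is $u_1u_2u_3\cdots$ and its output word is $v_1v_2v_3\cdots$. The infinitary rational relation $R(\mathcal T)\subseteq\Sigma^\omega\times\Gamma^\omega$ recognized by $\mathcal T$ is the set of pairs $(u,v)$ of infinite words such that $u$ and $v$ are the input and the output word of some successful computation of $\mathcal T$. A relation $R\subseteq\Sigma^\omega\times\Gamma^\omega$ is identified with the set of words $(u(1),v(1))(u(2),v(2))\cdots\in(\Sigma\times\Gamma)^\omega$, $(u,v)\in R$. For a finite alphabet $X$, equip $X^\omega$ with the Cantor topology (the product of the discrete topologies). Let $\mathbf\Sigma^0_1$ be the class of open sets and $\mathbf\Pi^0_1$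 the class of closed sets; for $n\ge 1$ let $\mathbf\Sigma^0_{n+1}$ be the class of countable unions of $\mathbf\Pi^0_n$-sets, and $\mathbf\Pi^0_{n+1}$ the class of countable intersections of $\mathbf\Sigma^0_n$-sets. Put $\mathbf\Delta^0_4=\mathbf\Sigma^0_4\cap\mathbf\Pi^0_4$. **Corollary 5.5.** There exist finite alphabets $\Sigma,\Gamma$ and an infinitary rational relation $R\subseteq\Sigma^\omega\times\Gamma^\omega$ which, as a subset of $(\Sigma\times\Gamma)^\omega$, belongs to $\mathbf\Delta^0_4$ but does not belong to $\mathbf\Sigma^0_3\cup\mathbf\Pi^0_3$. -/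

import Mathlib

/-- The space `X^ω` of infinite words over the alphabet `X`; the `n`-th letter, counted from `0`,
of `w : OmegaWord X` is `w n`. -/
def OmegaWord (X : Type) : Type := ℕ → X

/-- The Cantor topology on `X^ω`: the product of the discrete topologies on `X`. -/
instance (X : Type) : TopologicalSpace (OmegaWord X) :=
  @Pi.topologicalSpace ℕ (fun _ => X) (fun _ => ⊥)

namespace OmegaWord

/-- The finite word formed by the first `k` letters of an infinite word. -/
def take {X : Type} (w : OmegaWord X) (k : ℕ) : List X :=
  List.ofFn fun i : Fin k => w i

/-- `IsConcat u w`: the infinite concatenation `u 0 · u 1 · u 2 ⋯` of finite words (some of which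
may be empty) is infinite and equal to `w`. That is, every finite concatenation
`u 0 ⋯ u (n - 1)` is a prefix of `w`, and the lengths of these concatenations are unbounded. -/
def IsConcat {X : Type} (u : ℕ → List X) (w : OmegaWord X) : Prop :=
  (∀ n : ℕ, (List.range n).flatMap u = w.take ((List.range n).flatMap u).length) ∧
    ∀ k : ℕ, ∃ n : ℕ, k ≤ ((List.range n).flatMap u).length

end OmegaWord

/-- A Büchi transducer with input alphabet `A` and output alphabet `B`. -/
structure BuchiTransducer (A B : Type) where
  /-- the set of states -/
  State : Type
  finite_state : Finite State
  /-- the set of transitions -/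
  trans : Set (State × List A × List B × State)
  finite_trans : trans.Finite
  /-- the initial state -/
  init : State
  /-- the set of accepting states -/
  accept : Set State

namespace BuchiTransducer

variable {A B : Type}

/-- The sequence of transitions `(q i, u i, v i, q (i + 1))`, `i ∈ ℕ`, is a computation of `T`. -/
def IsComputation (T : BuchiTransducer A B) (q : ℕ → T.State) (u : ℕ → List A)
    (v : ℕ → List B) : Prop :=
  q 0 = T.init ∧ ∀ i : ℕ, (q i, u i, v i, q (i + 1)) ∈ T.trans

/-- Büchi acceptance: some accepting state occurs infinitely often. -/
def IsSuccessful (T : BuchiTransducer A B) (q : ℕ → T.State) : Prop :=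
  ∃ f ∈ T.accept, {i : ℕ | q i = f}.Infinite

/-- The infinitary relation recognized by `T`: the pairs of *infinite* words that are the input
and the output word of some successful computation. -/
def relation (T : BuchiTransducer A B) : Set (OmegaWord A × OmegaWord B) :=
  {p | ∃ (q : ℕ → T.State) (u : ℕ → List A) (v : ℕ → List B),
    T.IsComputation q u v ∧ T.IsSuccessful q ∧
      OmegaWord.IsConcat u p.1 ∧ OmegaWord.IsConcat v p.2}

end BuchiTransducer

/-- `R ⊆ A^ω × B^ω` is an infinitary rational relation: it is recognized by a Büchi transducer. -/
def IsInfinitaryRational {A B : Type} (R : Set (OmegaWord A × OmegaWord B)) : Prop :=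
  ∃ T : BuchiTransducer A B, T.relation = R

/-- A relation `R ⊆ A^ω × B^ω`, seen as a language of infinite words over the alphabet `A × B`. -/
def toOmegaLanguage {A B : Type} (R : Set (OmegaWord A × OmegaWord B)) :
    Set (OmegaWord (A × B)) :=
  {w | ((fun n => (w n).1 : OmegaWord A), (fun n => (w n).2 : OmegaWord B)) ∈ R}

mutual

/-- `IsSigma n s`: the set `s` belongs to the Borel class `Σ⁰ₙ`, `n ≥ 1`.
There is no class for `n = 0`. -/
def IsSigma {Y : Type} [TopologicalSpace Y] : ℕ → Set Y → Prop
  | 0, _ => False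
  | 1, s => IsOpen s
  | n + 2, s => ∃ f : ℕ → Set Y, (∀ i, IsPi (n + 1) (f i)) ∧ s = ⋃ i, f i

/-- `IsPi n s`: the set `s` belongs to the Borel class `Π⁰ₙ`, `n ≥ 1`.
There is no class for `n = 0`. -/
def IsPi {Y : Type} [TopologicalSpace Y] : ℕ → Set Y → Prop
  | 0, _ => False
  | 1, s => IsClosed s
  | n + 2, s => ∃ f : ℕ → Set Y, (∀ i, IsSigma (n + 1) (f i)) ∧ s = ⋂ i, f i

end

/-!
The relation is recognized by a transducer that only controls the *lag* between its two heads.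
The input head reads one letter per step, the output head one or two, so after `p` steps the heads
stand at `p` and `p + l p`, where `l` starts at `0` and grows by at most `1` per step; in particular
`l p ≤ p`. Say that `(u, v)` has a *recurrent hit* if for some fixed lag `n` there are infinitely
many `p` with `u p = v (p + n) = 1`. This is a `Σ⁰₃` condition, and a Büchi transducer guesses `n`.

Its complement is handled by a second mode of the transducer, which tries to let the lag tend to
infinity while eventually never reading the pair `(1, 1)`. If there is no recurrent hit, the lag can
be increased greedily (`greedyLag`, `exists_isLagRun_climb`). Conversely, such a run excludes a
recurrent hit as long as the segments `v p, …, v (p + p + 1)` with `u p = 1` contain no drop from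
`1` to `0`: then a hit with lag `n` remains a hit for all lags between `n` and `p`. Having a drop is
an open condition, detected by the same kind of transducer, and the pairs with a drop are simply
accepted. The first letter of `u` selects the mode (`mem_relation_lagTransducer_iff`), so the
language is a Boolean combination of a clopen, an open and a `Σ⁰₃` set, hence `Δ⁰₄`.

For the lower bound, a matrix `x : ℕ → ℕ → Bool` is coded continuously by a pair of words without
drop that has a recurrent hit exactly when some row of `x` contains infinitely many `1`s
(`recurrentHit_matrix_iff`). In the second mode a `Σ⁰₃` presentation of the language, and in the first
mode a `Π⁰₃` presentation, would make the set of matrices with all rows finite a `Σ⁰₃` set. Two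
applications of the Baire category theorem refute this (`not_isSigma_three_rows_finite`).
-/

open Filter Topology

/-! ### Borel classes -/

theorem isPi_iff_isSigma_compl {Y : Type} [TopologicalSpace Y] :
    ∀ (n : ℕ) (s : Set Y), IsPi n s ↔ IsSigma n sᶜ
  | 0, s => by simp [IsPi, IsSigma]
  | 1, s => by simp [IsPi, IsSigma]
  | n + 2, s => by
    rw [IsPi, IsSigma]
    constructor
    · rintro ⟨f, hf, rfl⟩
      refine ⟨fun i => (f i)ᶜ, fun i => ?_, by simp⟩
      rw [isPi_iff_isSigma_compl (n + 1), compl_compl]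
      exact hf i
    · rintro ⟨f, hf, hs⟩
      refine ⟨fun i => (f i)ᶜ, fun i => ?_, by rw [← Set.compl_iUnion, ← hs, compl_compl]⟩
      exact (isPi_iff_isSigma_compl (n + 1) (f i)).1 (hf i)

theorem isSigma_iff_isPi_compl {Y : Type} [TopologicalSpace Y] (n : ℕ) (s : Set Y) :
    IsSigma n s ↔ IsPi n sᶜ := by
  rw [isPi_iff_isSigma_compl, compl_compl]

theorem IsSigma.preimage {Y Z : Type} [TopologicalSpace Y] [TopologicalSpace Z] {f : Y → Z}
    (hf : Continuous f) : ∀ {n : ℕ} {s : Set Z}, IsSigma n s → IsSigma n (f ⁻¹' s)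
  | 0, s, h => by simp [IsSigma] at h
  | 1, s, h => by
    simp only [IsSigma] at h ⊢
    exact h.preimage hf
  | n + 2, s, h => by
    simp only [IsSigma] at h ⊢
    obtain ⟨g, hg, rfl⟩ := h
    refine ⟨fun i => f ⁻¹' g i, fun i => ?_, Set.preimage_iUnion⟩
    rw [isPi_iff_isSigma_compl, ← Set.preimage_compl]
    exact IsSigma.preimage hf ((isPi_iff_isSigma_compl _ _).1 (hg i))

/-- Intersections and unions are treated together: complementation turns the step for one of them
into the inductive hypothesis for the other. -/
theorem isSigma_inter_and_union {Y : Type} [TopologicalSpace Y] :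
    ∀ (n : ℕ) (s t : Set Y), IsSigma n s → IsSigma n t → IsSigma n (s ∩ t) ∧ IsSigma n (s ∪ t)
  | 0, s, t, hs, _ => by simp [IsSigma] at hs
  | 1, s, t, hs, ht => by
    simp only [IsSigma] at hs ht ⊢
    exact ⟨hs.inter ht, hs.union ht⟩
  | n + 2, s, t, hs, ht => by
    simp only [IsSigma] at hs ht ⊢
    obtain ⟨f, hf, rfl⟩ := hs
    obtain ⟨g, hg, rfl⟩ := ht
    have key (i j : ℕ) := isSigma_inter_and_union (n + 1) _ _
      ((isPi_iff_isSigma_compl _ _).1 (hf i)) ((isPi_iff_isSigma_compl _ _).1 (hg j))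
    refine ⟨⟨fun k => f k.unpair.1 ∩ g k.unpair.2, fun k => ?_, ?_⟩,
      ⟨fun k => f k ∪ g k, fun k => ?_, Set.iUnion_union_distrib f g |>.symm⟩⟩
    · rw [isPi_iff_isSigma_compl, Set.compl_inter]
      exact (key _ _).2
    · rw [Set.iUnion_unpair (fun i j => f i ∩ g j), Set.iUnion_inter_iUnion]
    · rw [isPi_iff_isSigma_compl, Set.compl_union]
      exact (key _ _).1

/-- The ambiguous class `Δ⁰ₙ = Σ⁰ₙ ∩ Π⁰ₙ`. -/
def IsDelta {Y : Type} [TopologicalSpace Y] (n : ℕ) (s : Set Y) : Prop :=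
  IsSigma n s ∧ IsPi n s

namespace IsDelta

variable {Y : Type} [TopologicalSpace Y] {n : ℕ} {s t : Set Y}

theorem compl (h : IsDelta n s) : IsDelta n sᶜ :=
  ⟨by rw [isSigma_iff_isPi_compl, compl_compl]; exact h.2, (isSigma_iff_isPi_compl _ _).1 h.1⟩

theorem inter (hs : IsDelta n s) (ht : IsDelta n t) : IsDelta n (s ∩ t) := by
  refine ⟨(isSigma_inter_and_union n s t hs.1 ht.1).1, ?_⟩
  rw [isPi_iff_isSigma_compl, Set.compl_inter]
  exact (isSigma_inter_and_union n _ _ ((isPi_iff_isSigma_compl _ _).1 hs.2)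
    ((isPi_iff_isSigma_compl _ _).1 ht.2)).2

theorem union (hs : IsDelta n s) (ht : IsDelta n t) : IsDelta n (s ∪ t) := by
  rw [← compl_compl (s ∪ t), Set.compl_union]
  exact (hs.compl.inter ht.compl).compl

end IsDelta

theorem isSigma_iUnion {Y ι : Type} [TopologicalSpace Y] [Countable ι] [Nonempty ι] {n : ℕ}
    {f : ι → Set Y} (h : ∀ i, IsPi (n + 1) (f i)) : IsSigma (n + 2) (⋃ i, f i) := by
  obtain ⟨e, he⟩ := exists_surjective_nat ι
  rw [IsSigma]
  exact ⟨fun k => f (e k), fun k => h _, (he.iUnion_comp f).symm⟩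

theorem isPi_iInter {Y ι : Type} [TopologicalSpace Y] [Countable ι] [Nonempty ι] {n : ℕ}
    {f : ι → Set Y} (h : ∀ i, IsSigma (n + 1) (f i)) : IsPi (n + 2) (⋂ i, f i) := by
  obtain ⟨e, he⟩ := exists_surjective_nat ι
  rw [IsPi]
  exact ⟨fun k => f (e k), fun k => h _, (he.iInter_comp f).symm⟩

theorem IsSigma.isPi_succ {Y : Type} [TopologicalSpace Y] {n : ℕ} {s : Set Y}
    (h : IsSigma (n + 1) s) : IsPi (n + 2) s := by
  exact Set.iInter_const (ι := Unit) s ▸ isPi_iInter (ι := Unit) fun _ => h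

theorem IsPi.isSigma_succ {Y : Type} [TopologicalSpace Y] {n : ℕ} {s : Set Y}
    (h : IsPi (n + 1) s) : IsSigma (n + 2) s := by
  exact Set.iUnion_const (ι := Unit) s ▸ isSigma_iUnion (ι := Unit) fun _ => h

theorem IsClopen.isDelta {Y : Type} [TopologicalSpace Y] {s : Set Y} (h : IsClopen s) :
    ∀ n : ℕ, IsDelta (n + 1) s
  | 0 => by
    simp only [IsDelta, IsSigma, IsPi]
    exact ⟨h.2, h.1⟩
  | n + 1 => ⟨(h.isDelta n).2.isSigma_succ, (h.isDelta n).1.isPi_succ⟩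

/-! ### The set of matrices with finite rows -/

/-- The finitely supported binary sequences, enumerated by binary expansion, are dense. -/
theorem denseRange_testBit : DenseRange (fun n : ℕ => n.testBit) := by
  intro r
  refine mem_closure_of_tendsto (b := atTop)
    (f := fun K : ℕ => (Nat.ofBits (fun i : Fin K => r i)).testBit) ?_ (.of_forall fun K => ⟨_, rfl⟩)
  rw [tendsto_pi_nhds]
  intro k
  refine tendsto_const_nhds.congr' ?_
  filter_upwards [eventually_gt_atTop k] with K hK
  rw [Nat.testBit_ofBits_lt _ _ hK]

/-- The matrices whose rows all contain finitely many `1`s do not form a `Σ⁰₃` set. If they were the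
union of `G_δ` sets `A i`, then, in the Polish space of sequences of finitely supported rows (each
row being a discrete point), some `A i` would be dense in a cylinder fixing the rows below some `N`.
Among all matrices with these first rows, `A i` is then a dense `G_δ` set, as are the matrices
with infinitely many `1`s in row `N`; by Baire's theorem the two sets meet. -/
theorem not_isSigma_three_rows_finite :
    ¬ IsSigma 3 {x : ℕ → ℕ → Bool | ∀ n, ¬ ∃ᶠ k in atTop, x n k = true} := by
  intro h
  simp only [IsSigma, IsPi] at h
  obtain ⟨A, hA, hPA⟩ := h
  set bits : (ℕ → ℕ) → ℕ → ℕ → Bool := fun z n => (z n).testBit with hbits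
  have hbits_cont : Continuous bits := by
    refine continuous_pi fun n => ?_
    exact (continuous_of_discreteTopology (f := fun n : ℕ => n.testBit)).comp (continuous_apply n)
  have hbits_dense : DenseRange bits := DenseRange.piMap fun _ => denseRange_testBit
  -- a matrix `bits z` has finite rows, so it lies in some `A i`
  have hcover : ⋃ i, closure (bits ⁻¹' A i) = Set.univ := by
    refine Set.eq_univ_of_forall fun z => ?_
    have hz : bits z ∈ ⋃ i, A i := by
      rw [← hPA]
      intro n hn
      obtain ⟨k, hk, hk'⟩ := frequently_atTop.1 hn (z n)
      have : (z n).testBit k = false :=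
        Nat.testBit_eq_false_of_lt (hk.trans_lt Nat.lt_two_pow_self)
      simp_all
    obtain ⟨i, hi⟩ := Set.mem_iUnion.1 hz
    exact Set.mem_iUnion.2 ⟨i, subset_closure hi⟩
  obtain ⟨i, c, hc⟩ := nonempty_interior_of_iUnion_of_closed (fun _ => isClosed_closure) hcover
  obtain ⟨U, hU, hAU⟩ := hA i
  obtain ⟨-, ⟨c', N, rfl⟩, hcN, hNi⟩ := (PiNat.isTopologicalBasis_cylinders _).mem_nhds_iff.1
    (isOpen_interior.mem_nhds hc)
  replace hNi := hNi.trans interior_subset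
  rw [← (PiNat.mem_cylinder_iff_eq.1 hcN)] at hNi
  -- the rows below `N` are frozen to those of `bits c`
  let fr : (ℕ → ℕ → Bool) → ℕ → ℕ → Bool := fun y n => if n < N then bits c n else y n
  have hfr : Continuous fr := by
    refine continuous_pi fun n => ?_
    by_cases hn : n < N
    · simpa [fr, hn] using continuous_const
    · simpa [fr, hn] using continuous_apply n
  have hdense : Dense (fr ⁻¹' A i) := by
    rw [dense_iff_inter_open]
    intro V hV hVne
    obtain ⟨z, hz⟩ := hbits_dense.exists_mem_open hV hVne
    -- `mg a b` has the rows of `a` below `N` and those of `b` from `N` on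
    let mg : (ℕ → ℕ) → (ℕ → ℕ) → ℕ → ℕ := fun a b n => if n < N then a n else b n
    have hmg (a : ℕ → ℕ) : Continuous (mg a) := by
      refine continuous_pi fun n => ?_
      by_cases hn : n < N
      · simpa [mg, hn] using continuous_const
      · simpa [mg, hn] using continuous_apply n
    have hzc : mg c z ∈ closure (bits ⁻¹' A i) :=
      hNi (PiNat.mem_cylinder_iff.2 fun n hn => by simp [mg, hn])
    have hopen : IsOpen (PiNat.cylinder c N ∩ (bits ∘ mg z) ⁻¹' V) :=
      (PiNat.isOpen_cylinder _ c N).inter (hV.preimage (hbits_cont.comp (hmg z)))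
    obtain ⟨z', ⟨hz'c, hz'V⟩, hz'A⟩ := mem_closure_iff.1 hzc _ hopen
      ⟨PiNat.mem_cylinder_iff.2 fun n hn => by simp [mg, hn], by
        have : mg z (mg c z) = z := by
          funext n
          by_cases hn : n < N <;> simp [mg, hn]
        simpa [this] using hz⟩
    refine ⟨bits (mg z z'), hz'V, ?_⟩
    have : fr (bits (mg z z')) = bits z' := by
      funext n
      by_cases hn : n < N
      · simp [fr, hn, hbits, PiNat.mem_cylinder_iff.1 hz'c n hn]
      · simp [fr, hn, hbits, mg]
    rw [Set.mem_preimage, this]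
    exact hz'A
  have hUd (j : ℕ) : Dense (fr ⁻¹' U j) :=
    hdense.mono (Set.preimage_mono (hAU ▸ Set.iInter_subset U j))
  let W : ℕ → Set (ℕ → ℕ → Bool) := fun m => {y | ∃ k ≥ m, y N k = true}
  have hWo (m : ℕ) : IsOpen (W m) := by
    have : W m = ⋃ k ≥ m, {y | y N k = true} := by ext; simp [W]
    rw [this]
    refine isOpen_biUnion fun k _ => ?_
    have hev : Continuous fun y : ℕ → ℕ → Bool => y N k := by fun_prop
    exact (isOpen_discrete {true}).preimage hev
  have hWd (m : ℕ) : Dense (W m) := by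
    intro y
    refine mem_closure_of_tendsto (b := atTop)
      (f := fun K : ℕ => Function.update y N (Function.update (y N) K true)) ?_ ?_
    · rw [tendsto_pi_nhds]
      intro n
      rw [tendsto_pi_nhds]
      intro k
      refine tendsto_const_nhds.congr' ?_
      filter_upwards [eventually_gt_atTop k] with K hK
      by_cases hn : n = N
      · subst hn
        simp [hK.ne]
      · simp [hn]
    · filter_upwards [eventually_ge_atTop m] with K hK
      exact ⟨K, hK, by simp⟩
  have hD := dense_iInter_of_isOpen (f := fun j : ℕ => fr ⁻¹' U j ∩ W j)
    (fun j => ((hU j).preimage hfr).inter (hWo j)) (fun j => (hUd j).inter_of_isOpen_right (hWd j) (hWo j))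
  obtain ⟨y, hy⟩ := hD.nonempty
  rw [Set.mem_iInter] at hy
  have hyA : fr y ∈ ⋃ i, A i :=
    Set.mem_iUnion.2 ⟨i, hAU ▸ Set.mem_iInter.2 fun j => (hy j).1⟩
  rw [← hPA] at hyA
  refine hyA N (frequently_atTop.2 fun m => ?_)
  obtain ⟨k, hk, hyk⟩ := (hy m).2
  exact ⟨k, hk, by simpa [fr] using hyk⟩

/-! ### Transducers that control the lag between their heads -/

namespace OmegaWord

theorem take_add {X : Type} (w : OmegaWord X) (a b : ℕ) :
    w.take (a + b) = w.take a ++ List.ofFn fun i : Fin b => w (a + i) := by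
  simp [take, List.ofFn_add]

/-- If no factor is empty, being the factorization `u 0 · u 1 ⋯` of `w` can be checked factor by
factor; `s n` is the position at which the factor `u n` starts. -/
theorem isConcat_iff {X : Type} {u : ℕ → List X} {w : OmegaWord X} {s : ℕ → ℕ} (h0 : s 0 = 0)
    (hs : ∀ n, s (n + 1) = s n + (u n).length) (hu : ∀ n, u n ≠ []) :
    IsConcat u w ↔ ∀ n, u n = List.ofFn fun i : Fin (u n).length => w (s n + i) := by
  have hlen (n : ℕ) : ((List.range n).flatMap u).length = s n := by
    induction n with
    | zero => simp [h0]
    | succ n ih => rw [List.range_succ, List.flatMap_append, List.length_append, ih, hs]; simp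
  have hge (n : ℕ) : n ≤ s n := by
    induction n with
    | zero => simp
    | succ n ih =>
      have := List.length_pos_iff.2 (hu n)
      rw [hs]
      omega
  unfold IsConcat
  simp only [hlen]
  rw [and_iff_left fun k => ⟨k, hge k⟩]
  constructor
  · intro h n
    have h1 := h (n + 1)
    rw [List.range_succ, List.flatMap_append, hs, take_add, h n] at h1
    simpa using h1
  · intro h n
    induction n with
    | zero => simp [h0, take]
    | succ n ih =>
      rw [List.range_succ, List.flatMap_append, hs, take_add, ih, ← h n]
      simp

end OmegaWord

/-- The control states of the transducer. The states `free mode` let the lag grow freely and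
remember the first input letter `mode`. In `watch hit` the lag is constant, and `hit` tells whether
the last step read the pair `(1, 1)`. In `climb moved` the pair `(1, 1)` is forbidden, and `moved`
tells whether the last step increased the lag. In `dropped` a drop of `v` has been found. -/
inductive LagState : Type
  | start
  | free (mode : Bool)
  | watch (hit : Bool)
  | climb (moved : Bool)
  | dropped
  deriving Fintype, DecidableEq

namespace LagState

/-- `Step q a b o q'`: from `q` to `q'` the transducer reads `a` from the input word, and from the
output word `b`, followed by the letter `c` if `o = some c`; the latter increases the lag by `1`. -/
inductive Step : LagState → Bool → Bool → Option Bool → LagState → Prop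
  | start (a b : Bool) (o : Option Bool) : Step start a b o (free a)
  | free (m a b : Bool) (o : Option Bool) : Step (free m) a b o (free m)
  | free_watch (a b : Bool) : Step (free true) a b none (watch (a && b))
  | watch (x a b : Bool) : Step (watch x) a b none (watch (a && b))
  | free_climb (a b : Bool) (o : Option Bool) (h : (a && b) = false) :
      Step (free false) a b o (climb o.isSome)
  | climb (x a b : Bool) (o : Option Bool) (h : (a && b) = false) :
      Step (climb x) a b o (climb o.isSome)
  | drop : Step (free false) true true (some false) dropped
  | dropped (a b : Bool) : Step dropped a b none dropped

namespace Step

variable {q q' : LagState} {m x a b : Bool} {o : Option Bool}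

theorem eq_of_start (h : Step .start a b o q') : q' = .free a := by
  cases h
  rfl

theorem eq_of_free (h : Step (.free m) a b o q') :
    q' = .free m ∨ (m = true ∧ ∃ x, q' = .watch x) ∨
      (m = false ∧ ((∃ x, q' = .climb x) ∨ q' = .dropped)) := by
  cases h <;> simp

theorem eq_of_watch (h : Step (.watch x) a b o q') : o = none ∧ q' = .watch (a && b) := by
  cases h
  exact ⟨rfl, rfl⟩

theorem eq_of_climb (h : Step (.climb x) a b o q') :
    (a && b) = false ∧ q' = .climb o.isSome := by
  cases h
  exact ⟨‹_›, rfl⟩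

theorem eq_of_dropped (h : Step .dropped a b o q') : q' = .dropped := by
  cases h
  rfl

theorem of_eq_watch (h : Step q a b o (.watch x)) : o = none ∧ x = (a && b) := by
  cases h <;> exact ⟨rfl, rfl⟩

theorem of_eq_dropped (h : Step q a b o .dropped) :
    q = .dropped ∨ (a = true ∧ b = true ∧ o = some false) := by
  cases h <;> simp

end Step

end LagState

/-- The transducer with the transitions `LagState.Step`. It accepts if it hits `(1, 1)` infinitely
often with constant lag, or increases the lag infinitely often without hitting `(1, 1)`, or has found
a drop. -/
def lagTransducer : BuchiTransducer Bool Bool where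
  State := LagState
  finite_state := inferInstance
  trans := {t | ∃ q a b o q', LagState.Step q a b o q' ∧ t = (q, [a], b :: o.toList, q')}
  finite_trans := by
    refine (Set.finite_range fun p : LagState × Bool × Bool × Option Bool × LagState =>
      (p.1, [p.2.1], p.2.2.1 :: p.2.2.2.1.toList, p.2.2.2.2)).subset ?_
    rintro _ ⟨q, a, b, o, q', -, rfl⟩
    exact ⟨(q, a, b, o, q'), rfl⟩
  init := .start
  accept := {.watch true, .climb true, .dropped}

/-- A computation of `lagTransducer` on `(u, v)`, given by the states `q` and the lags `l`: before
step `p` the heads are at position `p` of `u` and at position `p + l p` of `v`. -/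
structure IsLagRun (u v : ℕ → Bool) (q : ℕ → LagState) (l : ℕ → ℕ) : Prop where
  q_zero : q 0 = .start
  l_zero : l 0 = 0
  step : ∀ p, (l (p + 1) = l p ∧ LagState.Step (q p) (u p) (v (p + l p)) none (q (p + 1))) ∨
    (l (p + 1) = l p + 1 ∧
      LagState.Step (q p) (u p) (v (p + l p)) (some (v (p + l p + 1))) (q (p + 1)))

/-- The computations on `(u, v)` are exactly the lag runs: the lag before step `p` is the number of
earlier steps that read two output letters. -/
theorem mem_relation_lagTransducer {u v : OmegaWord Bool} :
    (u, v) ∈ lagTransducer.relation ↔ ∃ q l, IsLagRun u v q l ∧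
      ∃ f ∈ lagTransducer.accept, {i | q i = f}.Infinite := by
  constructor
  · rintro ⟨q, x, y, ⟨hq, ht⟩, hacc, hu, hv⟩
    choose q₀ a b o q₁ hstep heq using ht
    have hx : ∀ i, x i = [a i] := fun i => congrArg (·.2.1) (heq i)
    have hy : ∀ i, y i = b i :: (o i).toList := fun i => congrArg (·.2.2.1) (heq i)
    have hq₀ : ∀ i, q i = q₀ i := fun i => congrArg (·.1) (heq i)
    have hq₁ : ∀ i, q (i + 1) = q₁ i := fun i => congrArg (·.2.2.2) (heq i)
    replace hstep : ∀ i, LagState.Step (q i) (a i) (b i) (o i) (q (i + 1)) := fun i => by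
      rw [hq₀, hq₁]
      exact hstep i
    let l : ℕ → ℕ := fun n => ∑ i ∈ Finset.range n, (o i).toList.length
    rw [OmegaWord.isConcat_iff (s := fun n => n) rfl (by simp [hx]) (by simp [hx])] at hu
    rw [OmegaWord.isConcat_iff (s := fun n => n + l n) (by simp [l])
      (by intro n; simp [hy, l, Finset.sum_range_succ]; ring) (by simp [hy])] at hv
    have ha : ∀ i, a i = u i := fun i => by
      have := hu i
      rw [hx] at this
      simpa using this
    refine ⟨q, l, ⟨hq, by simp [l], fun p => ?_⟩, hacc⟩
    have h := hv p
    rw [hy] at h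
    have hs := hstep p
    rw [ha] at hs
    cases ho : o p with
    | none =>
      simp only [ho] at h hs
      left
      refine ⟨by simp [l, Finset.sum_range_succ, ho], ?_⟩
      have hb : b p = v (p + l p) := (List.cons.inj h).1
      rwa [hb] at hs
    | some c =>
      simp only [ho] at h hs
      right
      refine ⟨by simp [l, Finset.sum_range_succ, ho], ?_⟩
      have hb : b p = v (p + l p) ∧ c = v (p + l p + 1) :=
        ⟨(List.cons.inj h).1, (List.cons.inj (List.cons.inj h).2).1⟩
      rwa [hb.1, hb.2] at hs
  · rintro ⟨q, l, ⟨hq, hl, hstep⟩, hacc⟩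
    let o : ℕ → Option Bool := fun p => if l (p + 1) = l p then none else some (v (p + l p + 1))
    have ho : ∀ p, LagState.Step (q p) (u p) (v (p + l p)) (o p) (q (p + 1)) ∧
        l (p + 1) = l p + (o p).toList.length := fun p => by
      rcases hstep p with ⟨h, hs⟩ | ⟨h, hs⟩
      · simpa [o, h] using hs
      · simpa [o, h] using hs
    refine ⟨q, fun p => [u p], fun p => v (p + l p) :: (o p).toList,
      ⟨hq, fun p => ⟨_, _, _, _, _, (ho p).1, rfl⟩⟩, hacc, ?_, ?_⟩
    · rw [OmegaWord.isConcat_iff (s := fun n => n) rfl (by simp) (by simp)]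
      simp
    · rw [OmegaWord.isConcat_iff (s := fun n => n + l n) (by simp [hl])
        (by intro n; simp [(ho n).2]; ring) (by simp)]
      intro p
      by_cases h : l (p + 1) = l p <;> simp [o, h]

/-- For some fixed lag `n`, the heads at `p` and `p + n` meet the pair `(1, 1)` infinitely often. -/
def RecurrentHit (u v : ℕ → Bool) : Prop :=
  ∃ n, ∃ᶠ p in atTop, u p = true ∧ v (p + n) = true

/-- At some `p` with `u p = 1`, the word `v` drops from `1` to `0` at a position that can be reached
with lag at most `p`, the largest lag possible at step `p`. -/
def HasDrop (u v : ℕ → Bool) : Prop :=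
  ∃ p, ∃ n ≤ p, u p = true ∧ v (p + n) = true ∧ v (p + n + 1) = false

namespace IsLagRun

variable {u v : ℕ → Bool} {q : ℕ → LagState} {l : ℕ → ℕ}

theorem lag_le (h : IsLagRun u v q l) (p : ℕ) : l p ≤ p := by
  induction p with
  | zero => simp [h.l_zero]
  | succ p ih => rcases h.step p with ⟨h, -⟩ | ⟨h, -⟩ <;> omega

theorem monotone_lag (h : IsLagRun u v q l) : Monotone l :=
  monotone_nat_of_le_succ fun p => by rcases h.step p with ⟨h, -⟩ | ⟨h, -⟩ <;> omega

/-- After the first step, the mode is that of the first input letter: only `u 0 = 1` allows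
`watch`, and only `u 0 = 0` allows `climb` and `dropped`. -/
theorem mode_eq (h : IsLagRun u v q l) (p : ℕ) :
    q (p + 1) = .free (u 0) ∨ (u 0 = true ∧ ∃ x, q (p + 1) = .watch x) ∨
      (u 0 = false ∧ ((∃ x, q (p + 1) = .climb x) ∨ q (p + 1) = .dropped)) := by
  have hs (p : ℕ) : ∃ o, LagState.Step (q p) (u p) (v (p + l p)) o (q (p + 1)) := by
    rcases h.step p with ⟨-, h⟩ | ⟨-, h⟩ <;> exact ⟨_, h⟩
  induction p with
  | zero =>
    obtain ⟨o, ho⟩ := hs 0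
    rw [h.q_zero] at ho
    exact Or.inl ho.eq_of_start
  | succ p ih =>
    obtain ⟨o, ho⟩ := hs (p + 1)
    rcases ih with ih | ⟨hu, x, ih⟩ | ⟨hu, ⟨x, ih⟩ | ih⟩ <;> rw [ih] at ho
    · exact ho.eq_of_free
    · exact Or.inr (Or.inl ⟨hu, _, ho.eq_of_watch.2⟩)
    · exact Or.inr (Or.inr ⟨hu, Or.inl ⟨_, ho.eq_of_climb.2⟩⟩)
    · exact Or.inr (Or.inr ⟨hu, Or.inr ho.eq_of_dropped⟩)

theorem watch_add (h : IsLagRun u v q l) {p : ℕ} {x : Bool} (hp : q p = .watch x) (k : ℕ) :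
    l (p + k) = l p ∧ ∃ x, q (p + k) = .watch x := by
  induction k with
  | zero => exact ⟨rfl, x, hp⟩
  | succ k ih =>
    obtain ⟨hl, y, hy⟩ := ih
    rcases h.step (p + k) with ⟨h1, hs⟩ | ⟨h1, hs⟩ <;> rw [hy] at hs <;> rw [← add_assoc]
    · exact ⟨h1.trans hl, _, hs.eq_of_watch.2⟩
    · simpa using hs.eq_of_watch.1

theorem hit_of_watch_true (h : IsLagRun u v q l) {p : ℕ} (hp : q (p + 1) = .watch true) :
    u p = true ∧ v (p + l (p + 1)) = true := by
  rcases h.step p with ⟨h1, hs⟩ | ⟨h1, hs⟩ <;> rw [hp] at hs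
  · rw [h1]
    simpa using hs.of_eq_watch.2.symm
  · simpa using hs.of_eq_watch.1

theorem recurrentHit (h : IsLagRun u v q l) (hw : {i | q i = .watch true}.Infinite) :
    RecurrentHit u v := by
  obtain ⟨p₀, hp₀⟩ := hw.nonempty
  refine ⟨l p₀, frequently_atTop.2 fun m => ?_⟩
  obtain ⟨i, hi, hmi⟩ := hw.exists_gt (m + p₀)
  obtain ⟨p, rfl⟩ : ∃ p, i = p + 1 := ⟨i - 1, by omega⟩
  obtain ⟨k, hk⟩ : ∃ k, p + 1 = p₀ + k := ⟨p + 1 - p₀, by omega⟩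
  have := h.hit_of_watch_true hi
  rw [hk, (h.watch_add hp₀ k).1] at this
  exact ⟨p, by omega, this⟩

theorem hasDrop (h : IsLagRun u v q l) : ∀ {i : ℕ}, q i = .dropped → HasDrop u v
  | 0, hi => by simp [h.q_zero] at hi
  | p + 1, hi => by
    rcases h.step p with ⟨h1, hs⟩ | ⟨h1, hs⟩ <;> rw [hi] at hs
    · rcases hs.of_eq_dropped with hq | ⟨-, -, hc⟩
      · exact h.hasDrop hq
      · simp at hc
    · rcases hs.of_eq_dropped with hq | ⟨ha, hb, hc⟩
      · exact h.hasDrop hq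
      · exact ⟨p, l p, h.lag_le p, ha, hb, by simpa using hc⟩

theorem climb_step (h : IsLagRun u v q l) {p : ℕ} {x : Bool} (hp : q p = .climb x) :
    (u p && v (p + l p)) = false ∧
      ((q (p + 1) = .climb false ∧ l (p + 1) = l p) ∨
        (q (p + 1) = .climb true ∧ l (p + 1) = l p + 1)) := by
  rcases h.step p with ⟨h1, hs⟩ | ⟨h1, hs⟩ <;> rw [hp] at hs <;>
    refine ⟨hs.eq_of_climb.1, ?_⟩
  · exact Or.inl ⟨hs.eq_of_climb.2, h1⟩
  · exact Or.inr ⟨hs.eq_of_climb.2, h1⟩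

theorem climb_of_le (h : IsLagRun u v q l) {p : ℕ} {x : Bool} (hp : q p = .climb x) {p' : ℕ}
    (hle : p ≤ p') : ∃ x, q p' = .climb x := by
  induction p', hle using Nat.le_induction with
  | base => exact ⟨x, hp⟩
  | succ p' _ ih =>
    obtain ⟨y, hy⟩ := ih
    rcases (h.climb_step hy).2 with h | h <;> exact ⟨_, h.1⟩

theorem exists_lag_ge (h : IsLagRun u v q l) (hc : {i | q i = .climb true}.Infinite) (n : ℕ) :
    ∃ p, n ≤ l p := by
  obtain ⟨p₀, hp₀⟩ := hc.nonempty
  induction n with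
  | zero => exact ⟨0, Nat.zero_le _⟩
  | succ n ih =>
    obtain ⟨p, hp⟩ := ih
    obtain ⟨i, hi, hmi⟩ := hc.exists_gt (p + p₀)
    obtain ⟨j, rfl⟩ : ∃ j, i = j + 1 := ⟨i - 1, by omega⟩
    obtain ⟨x, hx⟩ := h.climb_of_le hp₀ (show p₀ ≤ j by omega)
    have hmono := h.monotone_lag (show p ≤ j by omega)
    refine ⟨j + 1, ?_⟩
    rcases (h.climb_step hx).2 with ⟨h1, -⟩ | ⟨-, h1⟩
    · have hi' : q (j + 1) = .climb true := hi
      rw [h1] at hi'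
      simp at hi'
    · omega

/-- A lag tending to infinity excludes a recurrent hit unless there is a drop: a hit at lag `n`
persists, for lack of drops, up to the current lag, where hits are forbidden. -/
theorem hasDrop_or_not_recurrentHit (h : IsLagRun u v q l)
    (hc : {i | q i = .climb true}.Infinite) : HasDrop u v ∨ ¬ RecurrentHit u v := by
  by_contra! hcon
  obtain ⟨hd, n, hn⟩ := hcon
  obtain ⟨p₀, hp₀⟩ := hc.nonempty
  obtain ⟨p₁, hp₁⟩ := h.exists_lag_ge hc n
  obtain ⟨p, hp, hu, hv⟩ := frequently_atTop.1 hn (p₀ + p₁)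
  have hlag := hp₁.trans (h.monotone_lag (show p₁ ≤ p by omega))
  have hall : ∀ m, n ≤ m → m ≤ p → v (p + m) = true := by
    intro m hm
    induction m, hm using Nat.le_induction with
    | base => exact fun _ => hv
    | succ m _ ih =>
      intro hmp
      by_contra hf
      exact hd ⟨p, m, by omega, hu, ih (by omega), by simpa [← add_assoc] using hf⟩
  obtain ⟨x, hx⟩ := h.climb_of_le hp₀ (show p₀ ≤ p by omega)
  have := (h.climb_step hx).1
  rw [hu, hall _ hlag (h.lag_le p)] at this
  simp at this

end IsLagRun

/-! ### The relation recognized by the lag transducer -/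

theorem exists_isLagRun_watch {u v : ℕ → Bool} (h0 : u 0 = true) (h : RecurrentHit u v) :
    ∃ q l, IsLagRun u v q l ∧ {i | q i = .watch true}.Infinite := by
  obtain ⟨n, hn⟩ := h
  let q : ℕ → LagState := fun
    | 0 => .start
    | p + 1 => if p ≤ n then .free true else .watch (u p && v (p + n))
  refine ⟨q, fun p => min p n, ⟨rfl, by simp, fun p => ?_⟩, ?_⟩
  · rcases p with _ | p
    · rcases Nat.eq_zero_or_pos n with rfl | hpos
      · left
        simpa [q, h0] using LagState.Step.start (u 0) (v 0) none
      · right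
        refine ⟨by omega, ?_⟩
        simpa [q, h0] using LagState.Step.start (u 0) (v 0) (some (v 1))
    · by_cases hp : p + 1 < n
      · right
        refine ⟨by omega, ?_⟩
        simpa [q, show p ≤ n by omega, show p + 1 ≤ n by omega] using LagState.Step.free _ _ _ _
      · left
        refine ⟨by omega, ?_⟩
        simp only [q]
        rw [show min (p + 1) n = n by omega]
        by_cases hp' : p + 1 ≤ n
        · simpa [show p ≤ n by omega, hp'] using LagState.Step.free _ _ _ _
        · by_cases hp2 : p ≤ n
          · simpa [hp2, hp'] using LagState.Step.free_watch _ _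
          · simpa [hp2, hp'] using LagState.Step.watch _ _ _
  · refine Set.infinite_of_not_bddAbove ?_
    rintro ⟨B, hB⟩
    obtain ⟨p, hp, hu, hv⟩ := frequently_atTop.1 hn (B + n + 1)
    have : p + 1 ≤ B := hB (by simp [q, show ¬ p ≤ n by omega, hu, hv])
    omega

theorem exists_isLagRun_dropped {u v : ℕ → Bool} (h0 : u 0 = false) (h : HasDrop u v) :
    ∃ q l, IsLagRun u v q l ∧ {i | q i = .dropped}.Infinite := by
  obtain ⟨p₀, n, hn, hu, hv, hv'⟩ := h
  -- `u 0` is already used as the mode, so the drop is found after the first step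
  have hp₀ : p₀ ≠ 0 := by
    rintro rfl
    simp [h0] at hu
  let q : ℕ → LagState := fun p =>
    if p = 0 then .start else if p ≤ p₀ then .free false else .dropped
  refine ⟨q, fun p => if p ≤ p₀ then min p n else n + 1, ⟨rfl, by simp, fun p => ?_⟩, ?_⟩
  · rcases lt_trichotomy p p₀ with hp | rfl | hp
    · have hs (o : Option Bool) (b : Bool) : LagState.Step (q p) (u p) b o (q (p + 1)) := by
        rcases Nat.eq_zero_or_pos p with rfl | hpos
        · simpa [q, h0, hp, Nat.one_le_iff_ne_zero.2 hp₀] using LagState.Step.start (u 0) b o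
        · simpa [q, hpos.ne', hp.le, Nat.succ_le_of_lt hp] using LagState.Step.free _ _ _ _
      simp only [hs, and_true, hp.le, Nat.succ_le_of_lt hp, if_true]
      omega
    · right
      simpa [q, hp₀, hn, hu, hv, hv'] using LagState.Step.drop
    · left
      simpa [q, hp.not_ge, show ¬ p + 1 ≤ p₀ by omega, show p ≠ 0 by omega]
        using LagState.Step.dropped _ _
  · refine Set.infinite_of_not_bddAbove ?_
    rintro ⟨B, hB⟩
    have : B + p₀ + 1 ≤ B := hB (by simp [q])
    omega

open Classical in
/-- The lag that is increased whenever no hit with the increased lag lies ahead. -/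
noncomputable def greedyLag (u v : ℕ → Bool) : ℕ → ℕ
  | 0 => 0
  | p + 1 =>
    if ∀ i ≥ p + 1, (u i && v (i + (greedyLag u v p + 1))) = false then greedyLag u v p + 1
    else greedyLag u v p

theorem greedyLag_avoids (u v : ℕ → Bool) (p : ℕ) :
    greedyLag u v p = 0 ∨ ∀ i ≥ p, (u i && v (i + greedyLag u v p)) = false := by
  induction p with
  | zero => left; rfl
  | succ p ih =>
    rw [greedyLag]
    split_ifs with h
    · exact Or.inr h
    · exact ih.imp_right fun h i hi => h i (by omega)

theorem exists_isLagRun_climb {u v : ℕ → Bool} (h0 : u 0 = false) (h : ¬ RecurrentHit u v) :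
    ∃ q l, IsLagRun u v q l ∧ {i | q i = .climb true}.Infinite := by
  have hfin (n : ℕ) : ∃ P, ∀ i ≥ P, (u i && v (i + n)) = false := by
    by_contra! hcon
    exact h ⟨n, frequently_atTop.2 fun m => by simpa using hcon m⟩
  -- lag `0` may be hit before `P₀`, so the run stays in `free false` until then
  obtain ⟨P₀, hP₀⟩ := hfin 0
  have hstep (p : ℕ) : greedyLag u v (p + 1) = greedyLag u v p ∨
      greedyLag u v (p + 1) = greedyLag u v p + 1 := by
    rw [greedyLag]
    split_ifs <;> simp
  let q : ℕ → LagState := fun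
    | 0 => .start
    | p + 1 => if p ≤ P₀ then .free false
      else .climb (decide (greedyLag u v (p + 1) ≠ greedyLag u v p))
  refine ⟨q, greedyLag u v, ⟨rfl, rfl, fun p => ?_⟩, ?_⟩
  · let o : Option Bool := if greedyLag u v (p + 1) = greedyLag u v p then none
      else some (v (p + greedyLag u v p + 1))
    suffices hs : LagState.Step (q p) (u p) (v (p + greedyLag u v p)) o (q (p + 1)) by
      rcases hstep p with h | h
      · left; simpa [o, h] using hs
      · right; simpa [o, h] using hs
    have hdec : decide (greedyLag u v (p + 1) ≠ greedyLag u v p) = o.isSome := by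
      by_cases h : greedyLag u v (p + 1) = greedyLag u v p <;> simp [o, h]
    rcases p with _ | p
    · simpa [q, h0] using LagState.Step.start (u 0) _ o
    · by_cases hp : p + 1 ≤ P₀
      · simpa [q, hp, show p ≤ P₀ by omega] using LagState.Step.free _ _ _ _
      · have hav : (u (p + 1) && v (p + 1 + greedyLag u v (p + 1))) = false := by
          rcases greedyLag_avoids u v (p + 1) with h | h
          · rw [h]; exact hP₀ _ (by omega)
          · exact h _ le_rfl
        simp only [q, hp, if_false, hdec]
        by_cases hp' : p ≤ P₀
        · simpa only [hp', if_true] using LagState.Step.free_climb _ _ _ hav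
        · simpa only [hp', if_false] using LagState.Step.climb _ _ _ _ hav
  · refine Set.infinite_of_not_bddAbove ?_
    rintro ⟨B, hB⟩
    have hconst : ∀ p ≥ B + P₀ + 1, greedyLag u v p = greedyLag u v (B + P₀ + 1) := by
      intro p hp
      induction p, hp using Nat.le_induction with
      | base => rfl
      | succ p hp ih =>
        by_contra hne
        rw [← ih] at hne
        have : p + 1 ≤ B := hB (by simp [q, show ¬ p ≤ P₀ by omega, hne])
        omega
    obtain ⟨P, hP⟩ := hfin (greedyLag u v (B + P₀ + 1) + 1)
    have h1 := hconst (P + (B + P₀ + 1) + 1) (by omega)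
    rw [greedyLag, hconst (P + (B + P₀ + 1)) (by omega), if_pos fun i hi => hP i (by omega)] at h1
    omega

theorem mem_relation_lagTransducer_iff {u v : OmegaWord Bool} :
    (u, v) ∈ lagTransducer.relation ↔
      (u 0 = true ∧ RecurrentHit u v) ∨ (u 0 = false ∧ (HasDrop u v ∨ ¬ RecurrentHit u v)) := by
  rw [mem_relation_lagTransducer]
  constructor
  · rintro ⟨q, l, h, f, hf, hinf⟩
    obtain ⟨i, hi, hpos⟩ := hinf.exists_gt 0
    obtain ⟨p, rfl⟩ : ∃ p, i = p + 1 := ⟨i - 1, by omega⟩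
    have hm := h.mode_eq p
    have hi' : q (p + 1) = f := hi
    rw [hi'] at hm
    rcases hf with rfl | rfl | rfl
    · exact Or.inl ⟨by simpa using hm, h.recurrentHit hinf⟩
    · exact Or.inr ⟨by simpa using hm, h.hasDrop_or_not_recurrentHit hinf⟩
    · exact Or.inr ⟨by simpa using hm, Or.inl (h.hasDrop hi')⟩
  · rintro (⟨h0, h⟩ | ⟨h0, h | h⟩)
    · obtain ⟨q, l, hr, hi⟩ := exists_isLagRun_watch h0 h
      exact ⟨q, l, hr, _, Or.inl rfl, hi⟩
    · obtain ⟨q, l, hr, hi⟩ := exists_isLagRun_dropped h0 h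
      exact ⟨q, l, hr, _, Or.inr (Or.inr rfl), hi⟩
    · obtain ⟨q, l, hr, hi⟩ := exists_isLagRun_climb h0 h
      exact ⟨q, l, hr, _, Or.inr (Or.inl rfl), hi⟩

/-! ### Upper bounds for the Borel classes -/

theorem OmegaWord.isClopen_setOf_apply {X : Type} (n : ℕ) (Q : X → Prop) :
    IsClopen {w : OmegaWord X | Q (w n)} := by
  let _ : TopologicalSpace X := ⊥
  have _ : DiscreteTopology X := ⟨rfl⟩
  exact (isClopen_discrete {x | Q x}).preimage
    (continuous_apply n : Continuous fun w : ℕ → X => w n)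

/-- The set is in fact `Σ⁰₃`, being of the form `⋃ ⋂ ⋃` of clopen sets. -/
theorem isDelta_four_recurrentHit :
    IsDelta 4 {w : OmegaWord (Bool × Bool) |
      RecurrentHit (fun i => (w i).1) (fun i => (w i).2)} := by
  let H : ℕ → ℕ → Set (OmegaWord (Bool × Bool)) :=
    fun n p => {w | (w p).1 = true ∧ (w (p + n)).2 = true}
  have hH (n p : ℕ) : IsClopen (H n p) :=
    (OmegaWord.isClopen_setOf_apply p fun x : Bool × Bool => x.1 = true).inter
      (OmegaWord.isClopen_setOf_apply (p + n) fun x : Bool × Bool => x.2 = true)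
  have heq : {w : OmegaWord (Bool × Bool) |
      RecurrentHit (fun i => (w i).1) (fun i => (w i).2)} =
      ⋃ n, ⋂ m, ⋃ p : ℕ, H n (m + p) := by
    ext w
    simp only [RecurrentHit, frequently_atTop, Set.mem_ofPred_eq, Set.mem_iUnion, Set.mem_iInter, H]
    refine exists_congr fun n => forall_congr' fun m => ⟨?_, ?_⟩
    · rintro ⟨p, hp, h⟩
      exact ⟨p - m, by rwa [Nat.add_sub_cancel' hp]⟩
    · rintro ⟨p, h⟩
      exact ⟨m + p, by omega, h⟩
  rw [heq]
  constructor
  · exact isSigma_iUnion fun n => isPi_iInter fun m => isSigma_iUnion fun p =>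
      ((hH n (m + p)).isDelta 0).2
  · refine IsSigma.isPi_succ (isSigma_iUnion fun n => isPi_iInter fun m => ?_)
    rw [IsSigma]
    exact isOpen_iUnion fun p => (hH n (m + p)).2

theorem isDelta_four_hasDrop :
    IsDelta 4 {w : OmegaWord (Bool × Bool) |
      HasDrop (fun i => (w i).1) (fun i => (w i).2)} := by
  let H : ℕ × ℕ → Set (OmegaWord (Bool × Bool)) := fun t =>
    {w | (w (t.1 + t.2)).1 = true} ∩ ({w | (w (t.1 + t.2 + t.1)).2 = true} ∩
      {w | (w (t.1 + t.2 + t.1 + 1)).2 = false})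
  have hH (t : ℕ × ℕ) : IsClopen (H t) :=
    (OmegaWord.isClopen_setOf_apply _ fun x : Bool × Bool => x.1 = true).inter
      ((OmegaWord.isClopen_setOf_apply _ fun x : Bool × Bool => x.2 = true).inter
        (OmegaWord.isClopen_setOf_apply _ fun x : Bool × Bool => x.2 = false))
  have heq : {w : OmegaWord (Bool × Bool) |
      HasDrop (fun i => (w i).1) (fun i => (w i).2)} = ⋃ t, H t := by
    ext w
    simp only [HasDrop, Set.mem_ofPred_eq, Set.mem_iUnion, H, Prod.exists, Set.mem_inter_iff]
    constructor
    · rintro ⟨p, n, hn, h⟩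
      exact ⟨n, p - n, by rwa [Nat.add_sub_cancel' hn]⟩
    · rintro ⟨n, d, h⟩
      exact ⟨n + d, n, by omega, h⟩
  rw [heq]
  constructor
  · exact (isSigma_iUnion fun t => ((hH t).isDelta 0).2).isPi_succ.isSigma_succ
  · have : IsSigma 1 (⋃ t, H t) := by
      rw [IsSigma]
      exact isOpen_iUnion fun t => (hH t).2
    exact this.isPi_succ.isSigma_succ.isPi_succ

/-! ### Coding matrices by pairs of words -/

/-- The input word of the code of a matrix: `1` exactly at the powers of `4`, except that the letter
at `0`, which selects the mode, is `b`. -/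
def matrixMarks (b : Bool) (i : ℕ) : Bool :=
  if i = 0 then b else decide (4 ^ Nat.log 4 i = i)

/-- The output word of the code of `x`: at position `4 ^ k + n`, where `n < 3 * 4 ^ k`, it tells
whether one of the rows `0, …, n` of `x` has a `1` in column `k`. It does not decrease on such a
block, which is long enough to contain every position reachable from `4 ^ k` with lag `≤ 4 ^ k`. At
position `0` the truncated subtraction gives the value of `x 0 0`, which is harmless. -/
def matrixLevels (x : ℕ → ℕ → Bool) (i : ℕ) : Bool :=
  decide (∃ m : Fin (i - 4 ^ Nat.log 4 i + 1), x m (Nat.log 4 i) = true)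

theorem matrixMarks_pow (b : Bool) (k : ℕ) : matrixMarks b (4 ^ k) = true := by
  simp [matrixMarks, Nat.log_pow]

theorem exists_eq_pow_of_matrixMarks {b : Bool} {i : ℕ} (hi : i ≠ 0)
    (h : matrixMarks b i = true) : ∃ k, i = 4 ^ k := by
  simp only [matrixMarks, hi, if_false, decide_eq_true_eq] at h
  exact ⟨_, h.symm⟩

theorem log_four_pow_add {k n : ℕ} (hn : n < 3 * 4 ^ k) : Nat.log 4 (4 ^ k + n) = k := by
  rw [Nat.log_eq_iff (Or.inr ⟨by norm_num, by positivity⟩), pow_succ]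
  omega

theorem matrixLevels_pow_add {x : ℕ → ℕ → Bool} {k n : ℕ} (hn : n < 3 * 4 ^ k) :
    matrixLevels x (4 ^ k + n) = true ↔ ∃ m ≤ n, x m k = true := by
  simp [matrixLevels, log_four_pow_add hn, Fin.exists_iff]

theorem recurrentHit_matrix_iff {b : Bool} {x : ℕ → ℕ → Bool} :
    RecurrentHit (matrixMarks b) (matrixLevels x) ↔ ∃ n, ∃ᶠ k in atTop, x n k = true := by
  have hsmall {n k : ℕ} (h : n ≤ k) : n < 3 * 4 ^ k := by
    have := Nat.lt_pow_self (n := k) (a := 4) (by norm_num)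
    omega
  constructor
  · rintro ⟨n, hn⟩
    by_contra! hcon
    have hev : ∀ᶠ k in atTop, ∀ m ∈ Set.Iic n, ¬ x m k = true :=
      (eventually_all_finite (Set.finite_Iic n)).2 fun m _ => hcon m
    obtain ⟨K, hK⟩ := eventually_atTop.1 hev
    obtain ⟨p, hp, hu, hv⟩ := frequently_atTop.1 hn (4 ^ (K + n))
    obtain ⟨k, rfl⟩ := exists_eq_pow_of_matrixMarks
      ((show 0 < 4 ^ (K + n) by positivity).trans_le hp).ne' hu
    have hk : K + n ≤ k := (Nat.pow_le_pow_iff_right (by norm_num)).1 hp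
    obtain ⟨m, hm, hx⟩ := (matrixLevels_pow_add (hsmall (by omega))).1 hv
    exact hK k (by omega) m hm hx
  · rintro ⟨n, hn⟩
    refine ⟨n, frequently_atTop.2 fun M => ?_⟩
    obtain ⟨k, hk, hx⟩ := frequently_atTop.1 hn (M + n)
    have := Nat.lt_pow_self (n := k) (a := 4) (by norm_num)
    exact ⟨4 ^ k, by omega, matrixMarks_pow b k,
      (matrixLevels_pow_add (hsmall (by omega))).2 ⟨n, le_rfl, hx⟩⟩

theorem not_hasDrop_matrix {x : ℕ → ℕ → Bool} :
    ¬ HasDrop (matrixMarks false) (matrixLevels x) := by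
  rintro ⟨p, n, hn, hu, hv, hv'⟩
  have hp : p ≠ 0 := by
    rintro rfl
    simp [matrixMarks] at hu
  obtain ⟨k, rfl⟩ := exists_eq_pow_of_matrixMarks hp hu
  have hk : 0 < 4 ^ k := by positivity
  obtain ⟨m, hm, hx⟩ := (matrixLevels_pow_add (by omega)).1 hv
  rw [add_assoc, ← Bool.not_eq_true, matrixLevels_pow_add (by omega)] at hv'
  exact hv' ⟨m, by omega, hx⟩

/-- The code of the matrix `x` for the mode `b`. -/
def matrixWord (b : Bool) (x : ℕ → ℕ → Bool) : OmegaWord (Bool × Bool) :=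
  fun i => (matrixMarks b i, matrixLevels x i)

theorem continuous_matrixWord (b : Bool) : Continuous (matrixWord b) := by
  let _ : TopologicalSpace (Bool × Bool) := ⊥
  have _ : DiscreteTopology (Bool × Bool) := ⟨rfl⟩
  refine (continuous_pi fun i => ?_ : Continuous (matrixWord b : (ℕ → ℕ → Bool) → ℕ → Bool × Bool))
  -- the letter at `i` only depends on finitely many entries
  let e : (ℕ → ℕ → Bool) → (Fin (i - 4 ^ Nat.log 4 i + 1) → Bool) := fun x m => x m (Nat.log 4 i)
  have he : Continuous e := by fun_prop
  let d : (Fin (i - 4 ^ Nat.log 4 i + 1) → Bool) → Bool × Bool :=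
    fun r => (matrixMarks b i, decide (∃ m, r m = true))
  have hd : Continuous d := continuous_of_discreteTopology
  have : (fun x => matrixWord b x i) = d ∘ e := by
    funext x
    simp [matrixWord, matrixLevels, d, e]
  exact this ▸ hd.comp he

/-! ### A rational relation of ambiguous class four -/

/-- Some infinitary rational relation is a `Δ⁰₄` set that is neither `Σ⁰₃` nor `Π⁰₃`. -/
theorem corollary5p5 :
    ∃ (A B : Type) (_ : Finite A) (_ : Finite B) (R : Set (OmegaWord A × OmegaWord B)),
      IsInfinitaryRational R ∧
      (IsSigma 4 (toOmegaLanguage R) ∧ IsPi 4 (toOmegaLanguage R)) ∧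
      ¬ (IsSigma 3 (toOmegaLanguage R) ∨ IsPi 3 (toOmegaLanguage R)) := by
  refine ⟨Bool, Bool, inferInstance, inferInstance, lagTransducer.relation, ⟨_, rfl⟩, ?_, ?_⟩
  · have heq : toOmegaLanguage lagTransducer.relation =
        ({w | (w 0).1 = true} ∩ {w | RecurrentHit (fun i => (w i).1) (fun i => (w i).2)}) ∪
        ({w | (w 0).1 = false} ∩ ({w | HasDrop (fun i => (w i).1) (fun i => (w i).2)} ∪
          {w | RecurrentHit (fun i => (w i).1) (fun i => (w i).2)}ᶜ)) := by
      ext w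
      exact mem_relation_lagTransducer_iff
    rw [heq]
    have hmode (b : Bool) : IsDelta 4 {w : OmegaWord (Bool × Bool) | (w 0).1 = b} :=
      (OmegaWord.isClopen_setOf_apply 0 fun x : Bool × Bool => x.1 = b).isDelta 3
    exact ((hmode true).inter isDelta_four_recurrentHit).union
      ((hmode false).inter (isDelta_four_hasDrop.union isDelta_four_recurrentHit.compl))
  · -- on codes of matrices the two modes decide complementary properties
    have hmem (b : Bool) (x : ℕ → ℕ → Bool) :
        matrixWord b x ∈ toOmegaLanguage lagTransducer.relation ↔
          ((b = true ∧ ∃ n, ∃ᶠ k in atTop, x n k = true) ∨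
            (b = false ∧ ¬ ∃ n, ∃ᶠ k in atTop, x n k = true)) := by
      refine mem_relation_lagTransducer_iff.trans ?_
      change (b = true ∧ RecurrentHit (matrixMarks b) (matrixLevels x)) ∨ (b = false ∧
        (HasDrop (matrixMarks b) (matrixLevels x) ∨
          ¬ RecurrentHit (matrixMarks b) (matrixLevels x))) ↔ _
      rw [recurrentHit_matrix_iff]
      cases b <;> simp [not_hasDrop_matrix]
    rintro (h | h)
    · refine not_isSigma_three_rows_finite ?_
      convert h.preimage (continuous_matrixWord false) using 1
      ext x
      simp [hmem]
    · rw [isPi_iff_isSigma_compl] at h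
      refine not_isSigma_three_rows_finite ?_
      convert h.preimage (continuous_matrixWord true) using 1
      ext x
      simp [hmem]
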